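/- Let $\mathbb{B}=\{x\in\mathbb{C}^n : \|x\|<1\}$ be the unit ball with its Bergman metric $h_{i\bar j}(x)=\partial_i\bar\partial_j\log K(x,x)$, where $K$ is the Bergman kernel of $\mathbb{B}$ (the reproducing kernel of the space of square-integrable holomorphic functions on $\mathbb{B}$). Let $\nabla_{\mathbb{B}}$ be the connection of this metric in the holomorphic tangent bundle of $\mathbb{B}$, that is, $\nabla_{\partial_i}\partial_j=\sum_k\Gamma_{ij}^k\partial_k$ with $\Gamma_{ij}^k=\sum_l(\partial_i h_{j\bar l})\,h^{\bar l k}$, where $(h^{\bar l k})$ is the inverse matrix of $(h_{j\bar l})$. Let $U\subset\mathbb{C}$ be a domain (or any open set) and let $f:U\to\mathbb{B}$ be a holomorphic curve. Put $f^{(1)}=f'$ and $f^{(k)}=(\nabla_{\mathbb{B}})_{f'}f^{(k-1)}$ for $k\ge 2$, where for a smooth field $V=\sum_k V^k\partial_k$ along $f$ $$(\nabla_{\mathbb{B}})_{f'}V=\sum_k\Big(\frac{\partial V^k}{\partial z}+\sum_{i,j}(f^i)'\,V^j\,\Gamma_{ij}^k\circ f\Big)\partial_k .$$ Then the Wronskian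 $$W(\nabla_{\mathbb{B}},f)(z)=f^{(1)}(z)\wedge\cdots\wedge f^{(n)}(z)\in K^*_{\mathbb{B},f(z)},$$ with values in the dual of the canonical bundle $K_{\mathbb{B}}$ of $\mathbb{B}$, is holomorphic in $z\in U$; that is, for every constant-coefficient holomorphic $n$-form $\omega$ on $\mathbb{C}^n$ the function $\omega(f^{(1)},\dots,f^{(n)})$ is holomorphic on $U$. -/

import Mathlib

noncomputable section

namespace BergmanWronskian

open MeasureTheory

/-- The Wirtinger derivative `∂φ/∂xⁱ` of a function on (an open part of) `ℂⁿ`. -/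
def wirtinger {n : ℕ} (i : Fin n) (φ : (Fin n → ℂ) → ℂ) (x : Fin n → ℂ) : ℂ :=
  (1 / 2 : ℂ) * (fderiv ℝ φ x (Pi.single i 1) - Complex.I * fderiv ℝ φ x (Pi.single i Complex.I))

/-- The Wirtinger derivative `∂φ/∂x̄ⁱ` of a function on (an open part of) `ℂⁿ`. -/
def wirtingerBar {n : ℕ} (i : Fin n) (φ : (Fin n → ℂ) → ℂ) (x : Fin n → ℂ) : ℂ :=
  (1 / 2 : ℂ) * (fderiv ℝ φ x (Pi.single i 1) + Complex.I * fderiv ℝ φ x (Pi.single i Complex.I))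

/-- The Wirtinger derivative `∂V/∂z` of a vector-valued function of one complex variable. -/
def wirtingerCurve {n : ℕ} (V : ℂ → (Fin n → ℂ)) (z : ℂ) : Fin n → ℂ :=
  (1 / 2 : ℂ) • (fderiv ℝ V z 1 - Complex.I • fderiv ℝ V z Complex.I)

/-- The unit ball of `ℂⁿ` for the Euclidean (Hermitian) norm. -/
def unitBall (n : ℕ) : Set (Fin n → ℂ) := {x | ∑ i, ‖x i‖ ^ 2 < 1}

/-- The Bergman space `A²(Ω)`: holomorphic functions on `Ω`, square integrable for Lebesgue
measure on `Ω` (functions are compared on `Ω` only). -/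
def BergmanSpace {n : ℕ} (Ω : Set (Fin n → ℂ)) : Set ((Fin n → ℂ) → ℂ) :=
  {g | DifferentiableOn ℂ g Ω ∧ MemLp g 2 (volume.restrict Ω)}

/-- `k` represents evaluation at `y` on `A²(Ω)`: `g(y) = ∫_Ω g(x) conj(k(x)) dx`
for all `g ∈ A²(Ω)`. -/
def IsReproducingAt {n : ℕ} (Ω : Set (Fin n → ℂ)) (y : Fin n → ℂ) (k : (Fin n → ℂ) → ℂ) : Prop :=
  k ∈ BergmanSpace Ω ∧ ∀ g ∈ BergmanSpace Ω, g y = ∫ x in Ω, g x * starRingEnd ℂ (k x)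

open Classical in
/-- The Bergman kernel `K(x, y)` of `Ω`: the function `K(·, y)` is the element of `A²(Ω)` that
represents evaluation at `y`. For open `Ω` its values on `Ω` are uniquely determined. -/
def bergmanKernel {n : ℕ} (Ω : Set (Fin n → ℂ)) (x y : Fin n → ℂ) : ℂ :=
  if h : ∃ k, IsReproducingAt Ω y k then h.choose x else 0

/-- The potential `log K(x, x)` of the Bergman metric. -/
def bergmanPotential {n : ℕ} (Ω : Set (Fin n → ℂ)) (x : Fin n → ℂ) : ℂ :=
  ((Real.log (bergmanKernel Ω x x).re : ℝ) : ℂ)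

/-- The Bergman metric of `Ω`; the entry `(i, j)` is `h_{i j̄} = ∂_i ∂̄_j log K(x, x)`. -/
def bergmanMetric {n : ℕ} (Ω : Set (Fin n → ℂ)) (x : Fin n → ℂ) : Matrix (Fin n) (Fin n) ℂ :=
  Matrix.of fun i j => wirtinger i (wirtingerBar j (bergmanPotential Ω)) x

/-- The Christoffel symbols `Γ_{ij}^k = ∑_l (∂_i h_{j l̄}) h^{l̄ k}` of the metric connection of a
Hermitian metric `(h_{i j̄})` in the holomorphic tangent bundle, so that
`∇_{∂_i} ∂_j = ∑_k Γ_{ij}^k ∂_k`; here `(h^{l̄ k})` is the inverse matrix of `(h_{j l̄})`. -/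
def christoffel {n : ℕ} (h : (Fin n → ℂ) → Matrix (Fin n) (Fin n) ℂ)
    (x : Fin n → ℂ) (i j k : Fin n) : ℂ :=
  ∑ l, wirtinger i (fun y => h y j l) x * (h x)⁻¹ l k

/-- The covariant derivative `∇_{f'(z)} V` of a field `V` of holomorphic tangent vectors along a
holomorphic curve `f`, for the connection with Christoffel symbols `Γ`. Its `k`-th component is
`∂V^k/∂z + ∑_{i,j} (f^i)' V^j Γ_{ij}^k(f(z))`. -/
def covariantDeriv {n : ℕ} (Γ : (Fin n → ℂ) → Fin n → Fin n → Fin n → ℂ)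
    (f : ℂ → (Fin n → ℂ)) (V : ℂ → (Fin n → ℂ)) (z : ℂ) : Fin n → ℂ :=
  fun k => wirtingerCurve V z k + ∑ i, ∑ j, deriv f z i * V z j * Γ (f z) i j k

/-- The derivatives of a holomorphic curve: `jet Γ f k` is `f^{(k+1)}`, that is,
`f^{(1)} = f'` and `f^{(k+1)} = ∇_{f'} f^{(k)}`. -/
def jet {n : ℕ} (Γ : (Fin n → ℂ) → Fin n → Fin n → Fin n → ℂ)
    (f : ℂ → (Fin n → ℂ)) : ℕ → ℂ → (Fin n → ℂ)
  | 0 => deriv f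
  | k + 1 => covariantDeriv Γ f (jet Γ f k)

/-- The Wronskian `W(∇, f)(z) = f^{(1)}(z) ∧ ⋯ ∧ f^{(n)}(z)`, as an element of the dual of the
fibre at `f(z)` of the canonical bundle (the alternating `n`-forms on the tangent space):
it sends an `n`-form `ω` to `ω(f^{(1)}(z), …, f^{(n)}(z))`. -/
def wronskian {n : ℕ} (Γ : (Fin n → ℂ) → Fin n → Fin n → Fin n → ℂ)
    (f : ℂ → (Fin n → ℂ)) (z : ℂ) : Module.Dual ℂ ((Fin n → ℂ) [⋀^Fin n]→ₗ[ℂ] ℂ) where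
  toFun ω := ω fun j : Fin n => jet Γ f j z
  map_add' _ _ := rfl
  map_smul' _ _ := rfl

/-- A map into the dual of the space of `n`-forms with constant coefficients (the fibre of the
canonical bundle of `ℂⁿ`, in its standard trivialization by `dx¹ ∧ ⋯ ∧ dxⁿ`) is holomorphic
on `U` if its pairing with each such form is. -/
def IsHolomorphicOn {n : ℕ} (W : ℂ → Module.Dual ℂ ((Fin n → ℂ) [⋀^Fin n]→ₗ[ℂ] ℂ))
    (U : Set ℂ) : Prop :=
  ∀ ω : (Fin n → ℂ) [⋀^Fin n]→ₗ[ℂ] ℂ, DifferentiableOn ℂ (fun z => W z ω) U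

end BergmanWronskian

end

noncomputable section

namespace BergmanWronskian

open MeasureTheory
open scoped Matrix ContDiff

/-! The Bergman connection of the ball is projectively flat: with `p i = conj (x i) / (1 - ‖x‖²)`
one has `Γ_{ij}^k = p i δ_{jk} + p j δ_{ik}` (`christoffel_bergmanMetric_unitBall`). Hence `∇_{f'}
V` differs from `∂V/∂z` only by a multiple of `V` and a multiple of `f'` (`covariantDeriv_eq`). By
induction each covariant derivative of `f` is the ordinary one of the same order plus a smooth
combination of ordinary ones of lower order (`jet_sub_isSmoothCombination`). The change of frame is
unitriangular, so the Wronskian equals the classical one, which is holomorphic.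

The Christoffel symbols come from `K(x, x) = vol⁻¹ (1 - ‖x‖²)^{-(n+1)}`. This kernel is found
without an orthonormal basis: an automorphism moves `a` to `0`, where the mean value property
evaluates the integral (`integral_mul_star_ballJac`). -/

/-! ### The Hermitian product on the unit ball. -/

theorem dotProduct_star_self_eq {n : ℕ} (x : Fin n → ℂ) :
    x ⬝ᵥ star x = ((∑ i, ‖x i‖ ^ 2 : ℝ) : ℂ) := by
  simp [dotProduct, Complex.mul_conj, Complex.normSq_eq_norm_sq]

theorem star_dotProduct_star_comm {n : ℕ} (x y : Fin n → ℂ) :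
    star (x ⬝ᵥ star y) = y ⬝ᵥ star x := by
  simp [dotProduct, mul_comm]

theorem norm_dotProduct_star_sq_le {n : ℕ} (x y : Fin n → ℂ) :
    ‖x ⬝ᵥ star y‖ ^ 2 ≤ (∑ i, ‖x i‖ ^ 2) * ∑ i, ‖y i‖ ^ 2 := by
  have h : ‖x ⬝ᵥ star y‖ ≤ ∑ i, ‖x i‖ * ‖y i‖ := by
    refine (norm_sum_le _ _).trans_eq ?_
    simp
  exact (pow_le_pow_left₀ (norm_nonneg _) h 2).trans (Finset.sum_mul_sq_le_sq_mul_sq _ _ _)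

theorem norm_dotProduct_star_lt_one {n : ℕ} {x y : Fin n → ℂ} (hx : x ∈ unitBall n)
    (hy : y ∈ unitBall n) : ‖x ⬝ᵥ star y‖ < 1 := by
  have h := norm_dotProduct_star_sq_le x y
  have hx' : ∑ i, ‖x i‖ ^ 2 < 1 := hx
  have hy' : ∑ i, ‖y i‖ ^ 2 < 1 := hy
  have hx0 : 0 ≤ ∑ i, ‖x i‖ ^ 2 := by positivity
  have hy0 : 0 ≤ ∑ i, ‖y i‖ ^ 2 := by positivity
  have : ‖x ⬝ᵥ star y‖ ^ 2 < 1 := by nlinarith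
  nlinarith [norm_nonneg (x ⬝ᵥ star y)]

theorem one_sub_dotProduct_star_ne_zero {n : ℕ} {x y : Fin n → ℂ} (hx : x ∈ unitBall n)
    (hy : y ∈ unitBall n) : 1 - x ⬝ᵥ star y ≠ 0 := by
  intro h
  have := norm_dotProduct_star_lt_one hx hy
  rw [← sub_eq_zero.1 h] at this
  simp at this

theorem isOpen_unitBall (n : ℕ) : IsOpen (unitBall n) :=
  isOpen_lt (by fun_prop) continuous_const

theorem zero_mem_unitBall (n : ℕ) : (0 : Fin n → ℂ) ∈ unitBall n := by simp [unitBall]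

theorem neg_mem_unitBall {n : ℕ} {a : Fin n → ℂ} (ha : a ∈ unitBall n) : -a ∈ unitBall n := by
  simpa [unitBall] using ha

/-! ### Automorphisms of the ball and their Jacobians. -/

/-- The number `s = √(1 - ‖a‖²)`. -/
def ballRadius {n : ℕ} (a : Fin n → ℂ) : ℝ := √(1 - ∑ i, ‖a i‖ ^ 2)

theorem ballRadius_pos {n : ℕ} {a : Fin n → ℂ} (ha : a ∈ unitBall n) : 0 < ballRadius a :=
  Real.sqrt_pos.2 (sub_pos.2 ha)

theorem ballRadius_neg {n : ℕ} (a : Fin n → ℂ) : ballRadius (-a) = ballRadius a := by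
  simp [ballRadius]

theorem dotProduct_star_self_eq_ballRadius {n : ℕ} {a : Fin n → ℂ} (ha : a ∈ unitBall n) :
    a ⬝ᵥ star a = 1 - (ballRadius a : ℂ) ^ 2 := by
  rw [dotProduct_star_self_eq, ballRadius, ← Complex.ofReal_pow, Real.sq_sqrt]
  · push_cast; ring
  · exact (sub_pos.2 ha).le

/-- The automorphism of the unit ball which maps `a` to `0`. -/
def ballAut {n : ℕ} (a z : Fin n → ℂ) : Fin n → ℂ :=
  (1 - z ⬝ᵥ star a)⁻¹ •
    ((ballRadius a : ℂ) • (z - a) + ((z - a) ⬝ᵥ star a / (1 + ballRadius a)) • a)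

theorem ballAut_self {n : ℕ} (a : Fin n → ℂ) : ballAut a a = 0 := by simp [ballAut]

/-- For `a ≠ 0`, with `P` the orthogonal projection onto `ℂ a`, the numerator of `ballAut` is `(P +
s (1 - P)) (z - a)`. Since `‖a‖² = 1 - s²`, the coefficient `(1 - s) / ‖a‖²` becomes `1 / (1 + s)`,
which also covers `a = 0`. The same relation reduces the claim to a rational identity in the scalar
products. -/
theorem one_sub_ballAut_normSq {n : ℕ} {a z : Fin n → ℂ} (ha : a ∈ unitBall n)
    (hz : z ∈ unitBall n) :
    1 - ∑ i, ‖ballAut a z i‖ ^ 2 =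
      ballRadius a ^ 2 * (1 - ∑ i, ‖z i‖ ^ 2) / ‖1 - z ⬝ᵥ star a‖ ^ 2 := by
  have hs := ballRadius_pos ha
  have hd := one_sub_dotProduct_star_ne_zero hz ha
  have hd' : 1 - a ⬝ᵥ star z ≠ 0 := one_sub_dotProduct_star_ne_zero ha hz
  have hA := dotProduct_star_self_eq_ballRadius ha
  have hs1 : (1 + ballRadius a : ℂ) ≠ 0 := by exact_mod_cast (by positivity : 1 + ballRadius a ≠ 0)
  have ht : star (1 - z ⬝ᵥ star a) = 1 - a ⬝ᵥ star z := by
    rw [star_sub, star_one, star_dotProduct_star_comm]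
  have hn : ((‖1 - z ⬝ᵥ star a‖ ^ 2 : ℝ) : ℂ) = (1 - z ⬝ᵥ star a) * (1 - a ⬝ᵥ star z) := by
    rw [← ht, ← Complex.normSq_eq_norm_sq, Complex.normSq_eq_conj_mul_self]
    exact mul_comm _ _
  apply Complex.ofReal_injective
  rw [Complex.ofReal_div, hn, Complex.ofReal_mul, Complex.ofReal_sub, Complex.ofReal_sub,
    ← dotProduct_star_self_eq, ← dotProduct_star_self_eq]
  have hst : star (1 + (ballRadius a : ℂ)) = 1 + (ballRadius a : ℂ) := by simp
  have hst' : star (ballRadius a : ℂ) = (ballRadius a : ℂ) := by simp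
  simp only [ballAut, star_smul, star_add, star_sub, smul_dotProduct, dotProduct_smul,
    add_dotProduct, sub_dotProduct, dotProduct_add, dotProduct_sub, smul_eq_mul, star_inv₀, ht,
    star_div₀, star_dotProduct_star_comm, hst, hst', hA, Complex.ofReal_one, Complex.ofReal_pow,
    star_one, star_pow]
  generalize z ⬝ᵥ star a = t at *
  generalize a ⬝ᵥ star z = u at *
  generalize (ballRadius a : ℂ) = s at *
  field_simp
  ring

theorem ballAut_mem {n : ℕ} {a z : Fin n → ℂ} (ha : a ∈ unitBall n) (hz : z ∈ unitBall n) :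
    ballAut a z ∈ unitBall n := by
  have h := one_sub_ballAut_normSq ha hz
  have h1 : 0 < ballRadius a ^ 2 * (1 - ∑ i, ‖z i‖ ^ 2) / ‖1 - z ⬝ᵥ star a‖ ^ 2 := by
    have := ballRadius_pos ha
    have h2 : 0 < 1 - ∑ i, ‖z i‖ ^ 2 := sub_pos.2 hz
    have := norm_pos_iff.2 (one_sub_dotProduct_star_ne_zero hz ha)
    positivity
  rw [← h] at h1
  exact sub_pos.1 h1

theorem ballAut_neg_ballAut {n : ℕ} {a z : Fin n → ℂ} (ha : a ∈ unitBall n)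
    (hz : z ∈ unitBall n) : ballAut (-a) (ballAut a z) = z := by
  have hs := ballRadius_pos ha
  have hd := one_sub_dotProduct_star_ne_zero hz ha
  have hA := dotProduct_star_self_eq_ballRadius ha
  have hs0 : (ballRadius a : ℂ) ≠ 0 := by exact_mod_cast hs.ne'
  have hs1 : (1 + ballRadius a : ℂ) ≠ 0 := by exact_mod_cast (by positivity : 1 + ballRadius a ≠ 0)
  have hw : ballAut a z ⬝ᵥ star a = (z ⬝ᵥ star a - 1 + (ballRadius a : ℂ) ^ 2) / (1 - z ⬝ᵥ star a) := by
    simp only [ballAut, smul_dotProduct, add_dotProduct, sub_dotProduct, smul_eq_mul, hA]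
    field_simp
    ring
  have hden : 1 - ballAut a z ⬝ᵥ star (-a) = (ballRadius a : ℂ) ^ 2 / (1 - z ⬝ᵥ star a) := by
    rw [star_neg, dotProduct_neg, hw]
    field_simp
    ring
  have hnum : (ballAut a z - -a) ⬝ᵥ star (-a) =
      - ((z ⬝ᵥ star a) * (ballRadius a : ℂ) ^ 2 / (1 - z ⬝ᵥ star a)) := by
    rw [star_neg, dotProduct_neg, sub_dotProduct, neg_dotProduct, hw, hA]
    field_simp
    ring
  rw [ballAut, hden, hnum, ballRadius_neg]
  ext i
  simp only [ballAut, sub_dotProduct, hA, Pi.smul_apply, Pi.add_apply, Pi.sub_apply, Pi.neg_apply,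
    smul_eq_mul]
  generalize z ⬝ᵥ star a = t at *
  generalize (ballRadius a : ℂ) = s at *
  field_simp
  ring

theorem ballAut_injOn {n : ℕ} {a : Fin n → ℂ} (ha : a ∈ unitBall n) :
    Set.InjOn (ballAut a) (unitBall n) := fun x hx y hy h => by
  rw [← ballAut_neg_ballAut ha hx, h, ballAut_neg_ballAut ha hy]

theorem ballAut_image {n : ℕ} {a : Fin n → ℂ} (ha : a ∈ unitBall n) :
    ballAut a '' unitBall n = unitBall n := by
  refine Set.Subset.antisymm (Set.image_subset_iff.2 fun z hz => ballAut_mem ha hz) fun w hw => ?_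
  refine ⟨ballAut (-a) w, ballAut_mem (neg_mem_unitBall ha) hw, ?_⟩
  simpa using ballAut_neg_ballAut (neg_mem_unitBall ha) hw

/-- The linear form `z ↦ ⟨z, a⟩`. -/
def hermForm {n : ℕ} (a : Fin n → ℂ) : (Fin n → ℂ) →L[ℂ] ℂ :=
  LinearMap.toContinuousLinearMap ((dotProductBilin ℂ ℂ).flip (star a))

@[simp]
theorem hermForm_apply {n : ℕ} (a z : Fin n → ℂ) : hermForm a z = z ⬝ᵥ star a := by
  simp [hermForm]

/-- The complex Jacobian determinant of `ballAut a`. -/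
def ballJac {n : ℕ} (a z : Fin n → ℂ) : ℂ := ((ballRadius a : ℂ) / (1 - z ⬝ᵥ star a)) ^ (n + 1)

theorem ballJac_ne_zero {n : ℕ} {a z : Fin n → ℂ} (ha : a ∈ unitBall n) (hz : z ∈ unitBall n) :
    ballJac a z ≠ 0 :=
  pow_ne_zero _ (div_ne_zero (by exact_mod_cast (ballRadius_pos ha).ne')
    (one_sub_dotProduct_star_ne_zero hz ha))

theorem exists_hasFDerivAt_ballAut {n : ℕ} {a z : Fin n → ℂ} (ha : a ∈ unitBall n)
    (hz : z ∈ unitBall n) : ∃ L : (Fin n → ℂ) →L[ℂ] (Fin n → ℂ),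
      HasFDerivAt (ballAut a) L z ∧ LinearMap.det (L : (Fin n → ℂ) →ₗ[ℂ] (Fin n → ℂ)) = ballJac a z := by
  have hs := ballRadius_pos ha
  have hd := one_sub_dotProduct_star_ne_zero hz ha
  have hA := dotProduct_star_self_eq_ballRadius ha
  have hs0 : (ballRadius a : ℂ) ≠ 0 := by exact_mod_cast hs.ne'
  have hs1 : (1 + ballRadius a : ℂ) ≠ 0 := by exact_mod_cast (by positivity : 1 + ballRadius a ≠ 0)
  have h1 : HasFDerivAt (fun z => 1 - z ⬝ᵥ star a) (-hermForm a) z := by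
    have := (hermForm a).hasFDerivAt (x := z)
    simpa using this.const_sub 1
  have h2 : HasFDerivAt (fun z => (ballRadius a : ℂ) • (z - a) +
      ((z - a) ⬝ᵥ star a / (1 + ballRadius a)) • a)
      ((ballRadius a : ℂ) • ContinuousLinearMap.id ℂ (Fin n → ℂ) +
        ((1 + ballRadius a : ℂ)⁻¹ • hermForm a).smulRight a) z := by
    have e1 := ((hasFDerivAt_id (𝕜 := ℂ) z).sub_const a).const_smul (ballRadius a : ℂ)
    have e2 := (((hermForm a).hasFDerivAt (x := z)).sub_const (a ⬝ᵥ star a)).const_smul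
      ((1 + ballRadius a : ℂ)⁻¹)
    refine (e1.add (e2.smul_const a)).congr_of_eventuallyEq (Filter.Eventually.of_forall fun w => ?_)
    simp [sub_dotProduct, div_eq_inv_mul]
  refine ⟨_, ((hasDerivAt_inv hd).comp_hasFDerivAt z h1).smul h2, ?_⟩
  set s : ℂ := (ballRadius a : ℂ) with hsdef
  set t := z ⬝ᵥ star a with ht
  -- The derivative is `s / (1 - t)` times two rank-one perturbations of the identity. Their
  -- determinants `1 / s` and `s² / (1 - t)` supply the extra factor that raises the exponent from
  -- `n` to `n + 1`.
  rw [show ((_ : (Fin n → ℂ) →L[ℂ] (Fin n → ℂ)) : (Fin n → ℂ) →ₗ[ℂ] (Fin n → ℂ)) =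
    ((1 - t)⁻¹ * s) • (LinearMap.transvection ((hermForm a).toLinearMap) ((s * (1 + s))⁻¹ • a) ∘ₗ
      LinearMap.transvection ((hermForm a).toLinearMap) ((1 - t)⁻¹ • (z - a))) from ?_]
  · rw [LinearMap.det_smul, LinearMap.det_comp, LinearMap.transvection.det,
      LinearMap.transvection.det]
    simp only [Module.finrank_fin_fun, ContinuousLinearMap.coe_coe, hermForm_apply, ballJac,
      smul_dotProduct, sub_dotProduct, smul_eq_mul, hA, ← ht]
    rw [pow_succ, div_eq_inv_mul]
    change _ = ((1 - t)⁻¹ * s) ^ n * _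
    congr 1
    change (1 + (s * (1 + s))⁻¹ * (1 - s ^ 2)) * (1 + (1 - t)⁻¹ * (t - (1 - s ^ 2))) = _
    field_simp
    ring
  · refine LinearMap.ext fun v => funext fun i => ?_
    simp [LinearMap.transvection.apply, ← ht, hA]
    generalize v ⬝ᵥ star a = r
    field_simp
    ring

/-! ### The mean value property over the ball. -/

theorem smul_mem_unitBall {n : ℕ} {u : ℂ} (hu : ‖u‖ ≤ 1) {w : Fin n → ℂ} (hw : w ∈ unitBall n) :
    u • w ∈ unitBall n := by
  change ∑ i, ‖(u • w) i‖ ^ 2 < 1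
  refine lt_of_le_of_lt (Finset.sum_le_sum fun i _ => ?_) (show ∑ i, ‖w i‖ ^ 2 < 1 from hw)
  rw [Pi.smul_apply, norm_smul]
  exact pow_le_pow_left₀ (by positivity) (mul_le_of_le_one_left (norm_nonneg _) hu) 2

theorem measurableSet_unitBall (n : ℕ) : MeasurableSet (unitBall n) :=
  (isOpen_unitBall n).measurableSet

theorem volume_unitBall_lt_top (n : ℕ) : volume (unitBall n) < ⊤ := by
  have hsub : unitBall n ⊆ Metric.closedBall 0 1 := by
    intro x hx
    replace hx : ∑ i, ‖x i‖ ^ 2 < 1 := hx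
    rw [mem_closedBall_zero_iff, pi_norm_le_iff_of_nonneg zero_le_one]
    intro i
    have h : ‖x i‖ ^ 2 < 1 := (Finset.single_le_sum (f := fun i => ‖x i‖ ^ 2)
      (fun i _ => by positivity) (Finset.mem_univ i)).trans_lt hx
    nlinarith [norm_nonneg (x i)]
  exact (measure_mono hsub).trans_lt (isCompact_closedBall (0 : Fin n → ℂ) 1).measure_lt_top

instance isFiniteMeasure_unitBall (n : ℕ) :
    IsFiniteMeasure ((volume : Measure (Fin n → ℂ)).restrict (unitBall n)) :=
  ⟨by simpa using volume_unitBall_lt_top n⟩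

theorem volume_real_unitBall_pos (n : ℕ) : 0 < volume.real (unitBall n) :=
  ENNReal.toReal_pos ((isOpen_unitBall n).measure_pos volume ⟨0, zero_mem_unitBall n⟩).ne'
    (volume_unitBall_lt_top n).ne

theorem measurePreserving_smul_unitBall {n : ℕ} {u : ℂ} (hu : ‖u‖ = 1) :
    MeasurePreserving (fun w : Fin n → ℂ => u • w) (volume.restrict (unitBall n))
      (volume.restrict (unitBall n)) := by
  have h1 : MeasurePreserving (fun z : ℂ => u * z) volume volume := by
    simpa [rotation_apply] using!
      (rotation ⟨u, mem_sphere_zero_iff_norm.2 hu⟩).measurePreserving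
  have h2 := volume_preserving_pi fun _ : Fin n => h1
  have h3 := h2.restrict_preimage (measurableSet_unitBall n)
  have h4 : (fun (a : Fin n → ℂ) i => u * a i) ⁻¹' unitBall n = unitBall n := by
    ext w
    simp [unitBall, hu]
  rwa [h4] at h3

theorem integral_smul_unitBall {n : ℕ} {E : Type*} [NormedAddCommGroup E] [NormedSpace ℝ E]
    (h : (Fin n → ℂ) → E) {u : ℂ} (hu : ‖u‖ = 1) :
    ∫ w in unitBall n, h (u • w) = ∫ w in unitBall n, h w :=
  (measurePreserving_smul_unitBall hu).integral_comp
    (measurableEmbedding_const_smul₀ (by rintro rfl; simp at hu)) h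

theorem integrableOn_smul_unitBall {n : ℕ} {h : (Fin n → ℂ) → ℂ} (hi : IntegrableOn h (unitBall n))
    {u : ℂ} (hu : ‖u‖ = 1) : IntegrableOn (fun w => h (u • w)) (unitBall n) :=
  (measurePreserving_smul_unitBall hu).integrable_comp_of_integrable hi

/-- One-variable mean value property for `u ↦ h (u • w)` on the closed unit disc, which the ball
contains after scaling `w`. -/
theorem circle_integral_smul_eq {n : ℕ} {h : (Fin n → ℂ) → ℂ}
    (hd : DifferentiableOn ℂ h (unitBall n)) {w : Fin n → ℂ} (hw : w ∈ unitBall n) :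
    ∫ θ in Set.Ioc 0 (2 * Real.pi), h (circleMap 0 1 θ • w) = (2 * Real.pi) • h 0 := by
  have hmaps : Set.MapsTo (fun u : ℂ => u • w) (Metric.closedBall 0 1) (unitBall n) :=
    fun u hu => smul_mem_unitBall (by simpa using hu) hw
  have h1 : DifferentiableOn ℂ (fun u : ℂ => h (u • w)) (Metric.closedBall 0 1) :=
    hd.comp (by fun_prop) hmaps
  have h2 : DiffContOnCl ℂ (fun u : ℂ => h (u • w)) (Metric.ball 0 |1|) := by
    refine DifferentiableOn.diffContOnCl ?_
    rwa [abs_one, closure_ball _ one_ne_zero]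
  have h3 := h2.circleAverage
  rw [Real.circleAverage_def, intervalIntegral.integral_of_le Real.two_pi_pos.le, zero_smul] at h3
  rw [← h3, smul_smul, mul_inv_cancel₀ Real.two_pi_pos.ne', one_smul]

/-- The mean value property of holomorphic functions on the unit ball. -/
theorem integral_unitBall_eq {n : ℕ} {h : (Fin n → ℂ) → ℂ}
    (hd : DifferentiableOn ℂ h (unitBall n)) (hi : IntegrableOn h (unitBall n)) :
    ∫ w in unitBall n, h w = volume.real (unitBall n) • h 0 := by
  set I := Set.Ioc 0 (2 * Real.pi)
  have hF : Integrable (fun p : ℝ × (Fin n → ℂ) => h (circleMap 0 1 p.1 • p.2))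
      ((volume.restrict I).prod (volume.restrict (unitBall n))) := by
    have hm : AEStronglyMeasurable (fun p : ℝ × (Fin n → ℂ) => h (circleMap 0 1 p.1 • p.2))
        ((volume.restrict I).prod (volume.restrict (unitBall n))) := by
      rw [Measure.prod_restrict]
      refine ContinuousOn.aestronglyMeasurable ?_
        (measurableSet_Ioc.prod (measurableSet_unitBall n))
      refine hd.continuousOn.comp ?_ fun p hp => smul_mem_unitBall (by simp) hp.2
      exact (((continuous_circleMap 0 1).comp continuous_fst).smul continuous_snd).continuousOn
    refine (integrable_prod_iff hm).2 ⟨Filter.Eventually.of_forall fun θ =>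
      integrableOn_smul_unitBall hi (u := circleMap 0 1 θ) (by simp), ?_⟩
    have : (fun θ : ℝ => ∫ w in unitBall n, ‖h (circleMap 0 1 θ • w)‖) =
        fun _ => ∫ w in unitBall n, ‖h w‖ :=
      funext fun θ => integral_smul_unitBall (fun w => ‖h w‖) (by simp)
    simp only [this]
    exact integrable_const _
  -- Rotation invariance of the measure makes one side `2π ∫ h`; the circle means make the other `2π
  -- vol · h 0`.
  have hs := integral_integral_swap (f := fun (θ : ℝ) w => h (circleMap 0 1 θ • w)) hF
  have hl : ∀ θ : ℝ, ∫ w in unitBall n, h (circleMap 0 1 θ • w) = ∫ w in unitBall n, h w :=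
    fun θ => integral_smul_unitBall h (by simp)
  simp only [hl] at hs
  rw [setIntegral_congr_fun (measurableSet_unitBall n)
    (fun w hw => circle_integral_smul_eq hd hw), setIntegral_const, setIntegral_const,
    Real.volume_real_Ioc_of_le Real.two_pi_pos.le, sub_zero, smul_comm] at hs
  exact smul_right_injective ℂ Real.two_pi_pos.ne' hs

/-! ### The Bergman kernel of the ball. -/

theorem differentiableOn_ballAut {n : ℕ} {a : Fin n → ℂ} (ha : a ∈ unitBall n) :
    DifferentiableOn ℂ (ballAut a) (unitBall n) := fun _ hz =>
  (exists_hasFDerivAt_ballAut ha hz).choose_spec.1.differentiableAt.differentiableWithinAt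

theorem differentiableOn_ballJac {n : ℕ} {a : Fin n → ℂ} (ha : a ∈ unitBall n) :
    DifferentiableOn ℂ (ballJac a) (unitBall n) := by
  have h1 : Differentiable ℂ fun z : Fin n → ℂ => 1 - hermForm a z := by fun_prop
  have h2 : DifferentiableOn ℂ (fun z : Fin n → ℂ => (ballRadius a : ℂ) * (1 - hermForm a z)⁻¹)
      (unitBall n) := (h1.differentiableOn.inv fun z hz => by
        simpa using one_sub_dotProduct_star_ne_zero hz ha).const_mul _
  refine (h2.pow (n + 1)).congr fun z _ => ?_
  simp [ballJac, div_eq_mul_inv]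

theorem exists_norm_ballJac_le {n : ℕ} {a : Fin n → ℂ} (ha : a ∈ unitBall n) :
    ∃ C, ∀ z ∈ unitBall n, ‖ballJac a z‖ ≤ C := by
  set r := √(∑ i, ‖a i‖ ^ 2) with hr
  have hr1 : r < 1 := by rw [hr, Real.sqrt_lt' one_pos]; simpa using! ha
  refine ⟨(ballRadius a / (1 - r)) ^ (n + 1), fun z hz => ?_⟩
  have hs := ballRadius_pos ha
  have h1 : ‖z ⬝ᵥ star a‖ ≤ r := by
    refine Real.le_sqrt_of_sq_le ((norm_dotProduct_star_sq_le z a).trans ?_)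
    exact mul_le_of_le_one_left (by positivity) (le_of_lt hz)
  have h2 : 1 - r ≤ ‖1 - z ⬝ᵥ star a‖ := by
    have := norm_sub_norm_le (1 : ℂ) (z ⬝ᵥ star a)
    rw [norm_one] at this
    linarith
  rw [ballJac, norm_pow, norm_div, Complex.norm_of_nonneg hs.le]
  have : 0 < 1 - r := sub_pos.2 hr1
  gcongr

theorem ballJac_mem_bergmanSpace {n : ℕ} {a : Fin n → ℂ} (ha : a ∈ unitBall n) :
    ballJac a ∈ BergmanSpace (unitBall n) := by
  obtain ⟨C, hC⟩ := exists_norm_ballJac_le ha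
  refine ⟨differentiableOn_ballJac ha, MemLp.of_bound
    ((differentiableOn_ballJac ha).continuousOn.aestronglyMeasurable (measurableSet_unitBall n)) C
    ((ae_restrict_iff' (measurableSet_unitBall n)).2 (Filter.Eventually.of_forall hC))⟩

/-- Write `g * conj J = (g / J) * |J|²` and substitute `w = ballAut a x`, whose real Jacobian is
`|J|²`. What remains is the integral of a holomorphic function of `w`, and its value at `w = 0` is
that of `g / J` at `a`. -/
theorem integral_mul_star_ballJac {n : ℕ} {a : Fin n → ℂ} (ha : a ∈ unitBall n)
    {g : (Fin n → ℂ) → ℂ} (hg : g ∈ BergmanSpace (unitBall n)) :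
    ∫ x in unitBall n, g x * starRingEnd ℂ (ballJac a x) =
      volume.real (unitBall n) • (g a / ballJac a a) := by
  have hB := measurableSet_unitBall n
  set h : (Fin n → ℂ) → ℂ := fun w => g (ballAut (-a) w) / ballJac a (ballAut (-a) w) with hh
  have hna := neg_mem_unitBall ha
  have hmap : Set.MapsTo (ballAut (-a)) (unitBall n) (unitBall n) := fun z hz => ballAut_mem hna hz
  have hd : DifferentiableOn ℂ h (unitBall n) :=
    ((hg.1.comp (differentiableOn_ballAut hna) hmap).mul
      (((differentiableOn_ballJac ha).comp (differentiableOn_ballAut hna) hmap).inv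
        fun z hz => ballJac_ne_zero ha (hmap hz))).congr fun z _ => div_eq_mul_inv _ _
  -- Membership stands under the existential so that `choose` yields a derivative field defined
  -- everywhere.
  have hex : ∀ z, ∃ L : (Fin n → ℂ) →L[ℝ] (Fin n → ℂ), z ∈ unitBall n →
      HasFDerivAt (ballAut a) L z ∧ |L.det| = ‖ballJac a z‖ ^ 2 := by
    intro z
    by_cases hz : z ∈ unitBall n
    · obtain ⟨L, hL, hdet⟩ := exists_hasFDerivAt_ballAut ha hz
      refine ⟨L.restrictScalars ℝ, fun _ => ⟨hL.restrictScalars ℝ, ?_⟩⟩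
      rw [← hdet]
      simp only [ContinuousLinearMap.det, ContinuousLinearMap.coe_restrictScalars,
        LinearMap.det_restrictScalars, Algebra.norm_complex_eq]
      simp [Complex.normSq_eq_norm_sq]
    · exact ⟨0, fun h => absurd h hz⟩
  choose L hL using hex
  have hL' : ∀ z ∈ unitBall n, HasFDerivWithinAt (ballAut a) (L z) (unitBall n) z :=
    fun z hz => (hL z hz).1.hasFDerivWithinAt
  have hcongr : Set.EqOn (fun x => |(L x).det| • h (ballAut a x))
      (fun x => g x * starRingEnd ℂ (ballJac a x)) (unitBall n) := by
    intro x hx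
    have hJ := ballJac_ne_zero ha hx
    simp only [hh, (hL x hx).2, ballAut_neg_ballAut ha hx, Complex.real_smul]
    rw [← Complex.normSq_eq_norm_sq, ← Complex.mul_conj]
    field_simp
  -- By the same substitution, this is integrability of a product of two `L²` functions.
  have hi : IntegrableOn h (unitBall n) := by
    have := integrableOn_image_iff_integrableOn_abs_det_fderiv_smul volume hB hL'
      (ballAut_injOn ha) h
    rw [ballAut_image ha] at this
    rw [this]
    refine IntegrableOn.congr_fun ?_ hcongr.symm hB
    exact hg.2.integrable_mul (ballJac_mem_bergmanSpace ha).2.star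
  have hint := integral_image_eq_integral_abs_det_fderiv_smul volume hB hL' (ballAut_injOn ha) h
  rw [ballAut_image ha, setIntegral_congr_fun hB hcongr, integral_unitBall_eq hd hi] at hint
  rw [← hint, hh]
  have : ballAut (-a) 0 = a := by
    rw [← ballAut_self a, ballAut_neg_ballAut ha ha]
  simp only [this]

theorem isReproducingAt_ball {n : ℕ} {a : Fin n → ℂ} (ha : a ∈ unitBall n) :
    IsReproducingAt (unitBall n) a
      (fun x => (starRingEnd ℂ (ballJac a a) / volume.real (unitBall n)) * ballJac a x) := by
  have hv : (volume.real (unitBall n) : ℂ) ≠ 0 := by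
    exact_mod_cast (volume_real_unitBall_pos n).ne'
  have hJ := ballJac_mem_bergmanSpace ha
  refine ⟨⟨hJ.1.const_mul _, hJ.2.const_mul _⟩, fun g hg => ?_⟩
  have : ∀ x, g x * starRingEnd ℂ
      ((starRingEnd ℂ (ballJac a a) / volume.real (unitBall n)) * ballJac a x) =
      (ballJac a a / volume.real (unitBall n)) * (g x * starRingEnd ℂ (ballJac a x)) := by
    intro x
    simp only [map_mul, map_div₀, Complex.conj_conj, Complex.conj_ofReal]
    ring
  simp only [this]
  rw [integral_const_mul, integral_mul_star_ballJac ha hg, Complex.real_smul]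
  have := ballJac_ne_zero ha ha
  field_simp

/-- Each representative is tested against the other. This identifies the diagonal value of the
chosen kernel without proving that representatives agree on `Ω`. -/
theorem IsReproducingAt.apply_self_eq_conj {n : ℕ} {Ω : Set (Fin n → ℂ)} {y : Fin n → ℂ}
    {k l : (Fin n → ℂ) → ℂ} (hk : IsReproducingAt Ω y k) (hl : IsReproducingAt Ω y l) :
    k y = starRingEnd ℂ (l y) := by
  rw [hl.2 k hk.1, hk.2 l hl.1, ← integral_conj]
  simp [mul_comm]

/-- The Bergman kernel of the unit ball on the diagonal. -/
theorem bergmanKernel_unitBall_self {n : ℕ} {a : Fin n → ℂ} (ha : a ∈ unitBall n) :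
    bergmanKernel (unitBall n) a a =
      (((volume.real (unitBall n))⁻¹ * ((1 - ∑ i, ‖a i‖ ^ 2)⁻¹) ^ (n + 1) : ℝ) : ℂ) := by
  have hex : ∃ k, IsReproducingAt (unitBall n) a k := ⟨_, isReproducingAt_ball ha⟩
  have hs : (ballRadius a : ℂ) ≠ 0 := by exact_mod_cast (ballRadius_pos ha).ne'
  have hJ : ballJac a a = (((ballRadius a)⁻¹ ^ (n + 1) : ℝ) : ℂ) := by
    rw [ballJac, dotProduct_star_self_eq_ballRadius ha, sub_sub_cancel]
    push_cast
    congr 1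
    field_simp
  have hsq : (1 - ∑ i, ‖a i‖ ^ 2) = ballRadius a ^ 2 := by
    rw [ballRadius, Real.sq_sqrt (sub_pos.2 ha).le]
  rw [bergmanKernel, dif_pos hex, hex.choose_spec.apply_self_eq_conj (isReproducingAt_ball ha), hJ,
    hsq]
  simp only [map_mul, map_div₀, Complex.conj_ofReal]
  push_cast
  rw [← inv_pow, ← pow_mul, mul_comm 2, pow_mul]
  field_simp

/-! ### Wirtinger calculus in several variables. -/

/-- The real-linear form `v ↦ ∑ i, (A i * v i + B i * conj (v i))`. -/
def wirtingerForm {n : ℕ} (A B : Fin n → ℂ) : (Fin n → ℂ) →L[ℝ] ℂ :=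
  ∑ i, (A i • (ContinuousLinearMap.proj i : (Fin n → ℂ) →L[ℝ] ℂ) +
    B i • (Complex.conjCLE : ℂ →L[ℝ] ℂ).comp (ContinuousLinearMap.proj i))

theorem wirtingerForm_apply {n : ℕ} (A B v : Fin n → ℂ) :
    wirtingerForm A B v = ∑ i, (A i * v i + B i * starRingEnd ℂ (v i)) := by
  simp [wirtingerForm]

/-- `φ` is real differentiable at `x` with `∂φ/∂xⁱ = A i` and `∂φ/∂x̄ⁱ = B i`. -/
def HasWirtingerAt {n : ℕ} (φ : (Fin n → ℂ) → ℂ) (A B x : Fin n → ℂ) : Prop :=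
  HasFDerivAt φ (wirtingerForm A B) x

namespace HasWirtingerAt

variable {n : ℕ} {φ ψ : (Fin n → ℂ) → ℂ} {A B C D x : Fin n → ℂ}

theorem wirtinger_eq (h : HasWirtingerAt φ A B x) (i : Fin n) : wirtinger i φ x = A i := by
  rw [wirtinger, h.fderiv]
  simp [wirtingerForm_apply, Pi.single_apply, Finset.sum_add_distrib, apply_ite (starRingEnd ℂ)]
  linear_combination (-1 / 2 * A i + 1 / 2 * B i) * Complex.I_sq

theorem wirtingerBar_eq (h : HasWirtingerAt φ A B x) (i : Fin n) : wirtingerBar i φ x = B i := by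
  rw [wirtingerBar, h.fderiv]
  simp [wirtingerForm_apply, Pi.single_apply, Finset.sum_add_distrib, apply_ite (starRingEnd ℂ)]
  linear_combination (1 / 2 * A i - 1 / 2 * B i) * Complex.I_sq

theorem congr_form (h : HasWirtingerAt φ A B x) (hA : A = C) (hB : B = D) :
    HasWirtingerAt φ C D x := hA ▸ hB ▸ h

theorem congr_of_eqOn (h : HasWirtingerAt φ A B x) {s : Set (Fin n → ℂ)} (hs : IsOpen s)
    (hx : x ∈ s) (he : Set.EqOn ψ φ s) : HasWirtingerAt ψ A B x :=
  HasFDerivAt.congr_of_eventuallyEq h (he.eventuallyEq_of_mem (hs.mem_nhds hx))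

theorem of_hasFDerivAt {L : (Fin n → ℂ) →L[ℝ] ℂ} (h : HasFDerivAt φ L x)
    (hL : ∀ v, L v = wirtingerForm A B v) : HasWirtingerAt φ A B x := by
  rwa [ContinuousLinearMap.ext hL] at h

theorem const (c : ℂ) : HasWirtingerAt (fun _ : Fin n → ℂ => c) 0 0 x := by
  have := hasFDerivAt_const (𝕜 := ℝ) c x
  refine of_hasFDerivAt this fun v => ?_
  simp [wirtingerForm_apply]

theorem coord (i : Fin n) : HasWirtingerAt (fun y : Fin n → ℂ => y i) (Pi.single i 1) 0 x := by
  have := (ContinuousLinearMap.proj (R := ℝ) (φ := fun _ : Fin n => ℂ) i).hasFDerivAt (x := x)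
  refine of_hasFDerivAt this fun v => ?_
  simp [wirtingerForm_apply, Pi.single_apply]

theorem conj_coord (i : Fin n) :
    HasWirtingerAt (fun y : Fin n → ℂ => starRingEnd ℂ (y i)) 0 (Pi.single i 1) x := by
  have := ((Complex.conjCLE : ℂ →L[ℝ] ℂ).comp
    (ContinuousLinearMap.proj (R := ℝ) (φ := fun _ : Fin n => ℂ) i)).hasFDerivAt (x := x)
  refine of_hasFDerivAt this fun v => ?_
  simp [wirtingerForm_apply, Pi.single_apply]

theorem add (h : HasWirtingerAt φ A B x) (h' : HasWirtingerAt ψ C D x) :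
    HasWirtingerAt (fun y => φ y + ψ y) (A + C) (B + D) x := by
  have := HasFDerivAt.add h h'
  refine of_hasFDerivAt this fun v => ?_
  simp [wirtingerForm_apply, ← Finset.sum_add_distrib]
  exact Finset.sum_congr rfl fun i _ => by ring

theorem mul (h : HasWirtingerAt φ A B x) (h' : HasWirtingerAt ψ C D x) :
    HasWirtingerAt (fun y => φ y * ψ y) (ψ x • A + φ x • C) (ψ x • B + φ x • D) x := by
  have := HasFDerivAt.mul h h'
  refine of_hasFDerivAt this fun v => ?_
  simp [wirtingerForm_apply, Finset.mul_sum, ← Finset.sum_add_distrib]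
  exact Finset.sum_congr rfl fun i _ => by ring

theorem sum {ι : Type*} (s : Finset ι) {φ : ι → (Fin n → ℂ) → ℂ} {A B : ι → Fin n → ℂ}
    (h : ∀ i ∈ s, HasWirtingerAt (φ i) (A i) (B i) x) :
    HasWirtingerAt (fun y => ∑ i ∈ s, φ i y) (∑ i ∈ s, A i) (∑ i ∈ s, B i) x := by
  classical
  induction s using Finset.induction_on with
  | empty => simpa using const 0
  | insert i s hi ih =>
    simp only [Finset.sum_insert hi]
    exact (h i (by simp)).add (ih fun j hj => h j (by simp [hj]))

theorem comp_holomorphic (h : HasWirtingerAt φ A B x) {g : ℂ → ℂ} {g' : ℂ}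
    (hg : HasDerivAt g g' (φ x)) : HasWirtingerAt (fun y => g (φ y)) (g' • A) (g' • B) x := by
  have := (hg.hasFDerivAt.restrictScalars ℝ).comp x h
  refine of_hasFDerivAt this fun v => ?_
  simp [wirtingerForm_apply]
  exact Finset.sum_congr rfl fun i _ => by ring

end HasWirtingerAt

/-! ### The Bergman metric of the ball and its Christoffel symbols. -/

/-- The function `1 - ‖x‖²`. -/
def ballRho {n : ℕ} (x : Fin n → ℂ) : ℂ := 1 - ∑ i, x i * starRingEnd ℂ (x i)

theorem ballRho_eq {n : ℕ} (x : Fin n → ℂ) :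
    ballRho x = ((1 - ∑ i, ‖x i‖ ^ 2 : ℝ) : ℂ) := by
  simp [ballRho, Complex.mul_conj, Complex.normSq_eq_norm_sq]

theorem ballRho_ne_zero {n : ℕ} {x : Fin n → ℂ} (hx : x ∈ unitBall n) : ballRho x ≠ 0 := by
  rw [ballRho_eq]
  exact_mod_cast (sub_pos.2 hx).ne'

theorem hasWirtingerAt_ballRho {n : ℕ} (x : Fin n → ℂ) :
    HasWirtingerAt ballRho (-star x) (-x) x := by
  have h := (HasWirtingerAt.const (x := x) (1 : ℂ)).add
    ((HasWirtingerAt.const (-1 : ℂ)).mul (HasWirtingerAt.sum Finset.univ fun i _ =>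
      (HasWirtingerAt.coord i).mul (HasWirtingerAt.conj_coord i)))
  have he : (fun y : Fin n → ℂ => 1 + -1 * ∑ i, y i * starRingEnd ℂ (y i)) = ballRho := by
    ext y
    simp [ballRho, sub_eq_add_neg]
  rw [he] at h
  refine h.congr_form ?_ ?_ <;> ext j <;> simp [Finset.sum_apply, Pi.single_apply]

theorem hasWirtingerAt_inv_ballRho {n : ℕ} {x : Fin n → ℂ} (hx : x ∈ unitBall n) :
    HasWirtingerAt (fun y => (ballRho y)⁻¹) ((ballRho x ^ 2)⁻¹ • star x) ((ballRho x ^ 2)⁻¹ • x)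
      x := by
  refine ((hasWirtingerAt_ballRho x).comp_holomorphic
    (hasDerivAt_inv (ballRho_ne_zero hx))).congr_form ?_ ?_ <;> simp

/-- Passing to `Complex.log` lets `comp_holomorphic` differentiate the potential. -/
theorem bergmanPotential_unitBall {n : ℕ} {x : Fin n → ℂ} (hx : x ∈ unitBall n) :
    bergmanPotential (unitBall n) x =
      (Real.log (volume.real (unitBall n))⁻¹ : ℂ) + (-(n + 1 : ℂ)) * Complex.log (ballRho x) := by
  have h1 : 0 < 1 - ∑ i, ‖x i‖ ^ 2 := sub_pos.2 hx
  have h2 := volume_real_unitBall_pos n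
  rw [bergmanPotential, bergmanKernel_unitBall_self hx, Complex.ofReal_re, ballRho_eq,
    ← Complex.ofReal_log h1.le, Real.log_mul (by positivity) (by positivity), Real.log_pow,
    Real.log_inv (1 - _)]
  push_cast
  ring

theorem wirtingerBar_bergmanPotential {n : ℕ} {x : Fin n → ℂ} (hx : x ∈ unitBall n) (j : Fin n) :
    wirtingerBar j (bergmanPotential (unitBall n)) x = (n + 1) * (x j * (ballRho x)⁻¹) := by
  have hslit : ballRho x ∈ Complex.slitPlane := by
    rw [ballRho_eq, Complex.ofReal_mem_slitPlane]
    exact sub_pos.2 hx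
  have h := (HasWirtingerAt.const (x := x) (Real.log (volume.real (unitBall n))⁻¹ : ℂ)).add
    ((HasWirtingerAt.const (-(n + 1 : ℂ))).mul
      ((hasWirtingerAt_ballRho x).comp_holomorphic (Complex.hasDerivAt_log hslit)))
  rw [(h.congr_of_eqOn (isOpen_unitBall n) hx fun y hy =>
    bergmanPotential_unitBall hy).wirtingerBar_eq]
  simp
  ring

/-- The Bergman metric of the unit ball. -/
theorem bergmanMetric_unitBall {n : ℕ} {x : Fin n → ℂ} (hx : x ∈ unitBall n) (i j : Fin n) :
    bergmanMetric (unitBall n) x i j =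
      (n + 1) * ((Pi.single i 1 : Fin n → ℂ) j * (ballRho x)⁻¹ +
        starRingEnd ℂ (x i) * x j * ((ballRho x)⁻¹ * (ballRho x)⁻¹)) := by
  have h := (HasWirtingerAt.const (x := x) (n + 1 : ℂ)).mul
    ((HasWirtingerAt.coord j).mul (hasWirtingerAt_inv_ballRho hx))
  rw [bergmanMetric, Matrix.of_apply, (h.congr_of_eqOn (isOpen_unitBall n) hx fun y hy =>
    wirtingerBar_bergmanPotential hy j).wirtinger_eq]
  simp [Pi.single_comm]
  ring

/-- The derivative is expressed through the metric itself, so contracting with the inverse matrix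
leaves Kronecker deltas and no explicit inverse is needed. -/
theorem wirtinger_bergmanMetric_unitBall {n : ℕ} {x : Fin n → ℂ} (hx : x ∈ unitBall n)
    (i j l : Fin n) :
    wirtinger i (fun y => bergmanMetric (unitBall n) y j l) x =
      (starRingEnd ℂ (x i) * bergmanMetric (unitBall n) x j l +
        starRingEnd ℂ (x j) * bergmanMetric (unitBall n) x i l) * (ballRho x)⁻¹ := by
  have hr := hasWirtingerAt_inv_ballRho hx
  have h := (HasWirtingerAt.const (x := x) (n + 1 : ℂ)).mul
    (((HasWirtingerAt.const ((Pi.single j 1 : Fin n → ℂ) l)).mul hr).add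
      (((HasWirtingerAt.conj_coord j).mul (HasWirtingerAt.coord l)).mul (hr.mul hr)))
  rw [(h.congr_of_eqOn (isOpen_unitBall n) hx fun y hy =>
    bergmanMetric_unitBall hy j l).wirtinger_eq, bergmanMetric_unitBall hx,
    bergmanMetric_unitBall hx]
  have := ballRho_ne_zero hx
  simp [Pi.single_comm l]
  field_simp
  ring

theorem isUnit_det_bergmanMetric_unitBall {n : ℕ} {x : Fin n → ℂ} (hx : x ∈ unitBall n) :
    IsUnit (bergmanMetric (unitBall n) x).det := by
  have hr := ballRho_ne_zero hx
  have hn : (n + 1 : ℂ) ≠ 0 := Nat.cast_add_one_ne_zero n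
  -- The Sherman–Morrison inverse of a scalar matrix plus a rank-one matrix, simplified by `‖x‖² = 1
  -- - ballRho x`.
  refine Matrix.isUnit_det_of_right_inverse (B := (ballRho x / (n + 1)) •
    (1 - Matrix.vecMulVec (star x) x)) ?_
  have hm : bergmanMetric (unitBall n) x = (n + 1 : ℂ) • ((ballRho x)⁻¹ • (1 : Matrix _ _ ℂ) +
      ((ballRho x)⁻¹ * (ballRho x)⁻¹) • Matrix.vecMulVec (star x) x) := by
    ext i j
    rw [bergmanMetric_unitBall hx]
    simp [Matrix.vecMulVec_apply, Matrix.one_apply, Pi.single_apply, eq_comm]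
    grind
  have hq : x ⬝ᵥ star x = 1 - ballRho x := by simp [ballRho, dotProduct]
  have hv : Matrix.vecMulVec (star x) x * Matrix.vecMulVec (star x) x =
      (1 - ballRho x) • Matrix.vecMulVec (star x) x := by
    rw [Matrix.vecMulVec_mul_vecMulVec, hq, Matrix.vecMulVec_smul]
  rw [hm]
  simp only [Matrix.smul_mul, Matrix.mul_smul, add_mul, mul_sub, one_mul, mul_one, hv]
  ext i j
  simp only [Matrix.smul_apply, Matrix.add_apply, Matrix.sub_apply, smul_eq_mul]
  field_simp
  ring

/-- The Christoffel symbols of the Bergman metric of the unit ball. -/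
theorem christoffel_bergmanMetric_unitBall {n : ℕ} {x : Fin n → ℂ} (hx : x ∈ unitBall n)
    (i j k : Fin n) :
    christoffel (bergmanMetric (unitBall n)) x i j k =
      (starRingEnd ℂ (x i) * (ballRho x)⁻¹) * (1 : Matrix (Fin n) (Fin n) ℂ) j k +
      (starRingEnd ℂ (x j) * (ballRho x)⁻¹) * (1 : Matrix (Fin n) (Fin n) ℂ) i k := by
  -- Both deltas are expanded as entries of `h * h⁻¹`, to compare the sums over `l` term by term.
  rw [← Matrix.mul_nonsing_inv _ (isUnit_det_bergmanMetric_unitBall hx), Matrix.mul_apply,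
    Matrix.mul_apply, Finset.mul_sum, Finset.mul_sum, ← Finset.sum_add_distrib, christoffel]
  refine Finset.sum_congr rfl fun l _ => ?_
  rw [wirtinger_bergmanMetric_unitBall hx]
  ring

/-! ### The operator `∂/∂z` on fields along a curve. -/

theorem wirtingerCurve_eq_of_eqOn {n : ℕ} {U : Set ℂ} (hU : IsOpen U) {V W : ℂ → Fin n → ℂ}
    (h : Set.EqOn V W U) {z : ℂ} (hz : z ∈ U) : wirtingerCurve V z = wirtingerCurve W z := by
  rw [wirtingerCurve, wirtingerCurve, (h.eventuallyEq_of_mem (hU.mem_nhds hz)).fderiv_eq]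

theorem wirtingerCurve_add {n : ℕ} {V W : ℂ → Fin n → ℂ} {z : ℂ} (hV : DifferentiableAt ℝ V z)
    (hW : DifferentiableAt ℝ W z) :
    wirtingerCurve (fun z => V z + W z) z = wirtingerCurve V z + wirtingerCurve W z := by
  simp only [wirtingerCurve, fderiv_fun_add hV hW, add_apply]
  module

theorem wirtingerCurve_sum {n : ℕ} {ι : Type*} (s : Finset ι) {V : ι → ℂ → Fin n → ℂ} {z : ℂ}
    (hV : ∀ i ∈ s, DifferentiableAt ℝ (V i) z) :
    wirtingerCurve (fun z => ∑ i ∈ s, V i z) z = ∑ i ∈ s, wirtingerCurve (V i) z := by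
  simp only [wirtingerCurve, fderiv_fun_sum hV, sum_apply, Finset.smul_sum,
    ← Finset.sum_sub_distrib]

theorem wirtingerCurve_of_differentiableAt {n : ℕ} {V : ℂ → Fin n → ℂ} {z : ℂ}
    (hV : DifferentiableAt ℂ V z) : wirtingerCurve V z = deriv V z := by
  rw [wirtingerCurve, hV.fderiv_restrictScalars ℝ]
  simp only [ContinuousLinearMap.coe_restrictScalars']
  have : fderiv ℂ V z Complex.I = Complex.I • fderiv ℂ V z 1 := by
    rw [← map_smul, smul_eq_mul, mul_one]
  rw [this, smul_smul, Complex.I_mul_I, ← fderiv_apply_one_eq_deriv]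
  module

/-- The Wirtinger derivative `∂a/∂z` of a scalar function of one complex variable. -/
def wirtingerScalar (a : ℂ → ℂ) (z : ℂ) : ℂ :=
  (1 / 2 : ℂ) * (fderiv ℝ a z 1 - Complex.I * fderiv ℝ a z Complex.I)

theorem wirtingerCurve_smul {n : ℕ} {a : ℂ → ℂ} {V : ℂ → Fin n → ℂ} {z : ℂ}
    (ha : DifferentiableAt ℝ a z) (hV : DifferentiableAt ℝ V z) :
    wirtingerCurve (fun z => a z • V z) z = wirtingerScalar a z • V z + a z • wirtingerCurve V z := by
  simp only [wirtingerCurve, wirtingerScalar, fderiv_fun_smul ha hV, add_apply,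
    smul_apply, ContinuousLinearMap.smulRight_apply]
  module

theorem contDiffOn_wirtingerScalar {U : Set ℂ} (hU : IsOpen U) {a : ℂ → ℂ}
    (ha : ContDiffOn ℝ ∞ a U) : ContDiffOn ℝ ∞ (wirtingerScalar a) U := by
  have h : ContDiffOn ℝ ∞ (fderiv ℝ a) U := ha.fderiv_of_isOpen hU (by simp)
  have h1 := h.clm_apply (contDiffOn_const (c := (1 : ℂ)))
  have h2 := h.clm_apply (contDiffOn_const (c := Complex.I))
  exact contDiffOn_const.mul (h1.sub (contDiffOn_const.mul h2))

/-! ### Smooth combinations of a sequence of fields. -/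

/-- On `U`, `V` is a combination of `D 0, …, D (k - 1)` with smooth coefficients. -/
def IsSmoothCombination {n : ℕ} (U : Set ℂ) (D : ℕ → ℂ → Fin n → ℂ) (k : ℕ)
    (V : ℂ → Fin n → ℂ) : Prop :=
  ∃ a : ℕ → ℂ → ℂ, (∀ j, ContDiffOn ℝ ∞ (a j) U) ∧
    ∀ z ∈ U, V z = ∑ j ∈ Finset.range k, a j z • D j z

namespace IsSmoothCombination

variable {n : ℕ} {U : Set ℂ} {D : ℕ → ℂ → Fin n → ℂ} {k l : ℕ} {V W : ℂ → Fin n → ℂ}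

theorem zero : IsSmoothCombination U D k (fun _ => 0) :=
  ⟨fun _ _ => 0, fun _ => contDiffOn_const, fun z _ => by simp⟩

theorem congr (h : IsSmoothCombination U D k V) (he : Set.EqOn W V U) :
    IsSmoothCombination U D k W := by
  obtain ⟨a, ha, h⟩ := h
  exact ⟨a, ha, fun z hz => (he hz).trans (h z hz)⟩

theorem add (hV : IsSmoothCombination U D k V) (hW : IsSmoothCombination U D k W) :
    IsSmoothCombination U D k (fun z => V z + W z) := by
  obtain ⟨a, ha, h⟩ := hV
  obtain ⟨b, hb, h'⟩ := hW
  exact ⟨fun j z => a j z + b j z, fun j => (ha j).add (hb j), fun z hz => by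
    simp only [h z hz, h' z hz, add_smul, Finset.sum_add_distrib]⟩

theorem smul {c : ℂ → ℂ} (hc : ContDiffOn ℝ ∞ c U) (hV : IsSmoothCombination U D k V) :
    IsSmoothCombination U D k (fun z => c z • V z) := by
  obtain ⟨a, ha, h⟩ := hV
  exact ⟨fun j z => c z * a j z, fun j => hc.mul (ha j), fun z hz => by
    simp only [h z hz, mul_smul, Finset.smul_sum]⟩

theorem sum {ι : Type*} (s : Finset ι) {V : ι → ℂ → Fin n → ℂ}
    (h : ∀ i ∈ s, IsSmoothCombination U D k (V i)) :
    IsSmoothCombination U D k (fun z => ∑ i ∈ s, V i z) := by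
  classical
  induction s using Finset.induction_on with
  | empty => simpa using zero
  | insert i s hi ih =>
    simp only [Finset.sum_insert hi]
    exact (h i (by simp)).add (ih fun j hj => h j (by simp [hj]))

theorem of_lt {j : ℕ} (hj : j < k) : IsSmoothCombination U D k (D j) := by
  refine ⟨fun i _ => if i = j then 1 else 0, fun _ => contDiffOn_const, fun z _ => ?_⟩
  simp [ite_smul, hj]

theorem mono (hV : IsSmoothCombination U D k V) (hkl : k ≤ l) : IsSmoothCombination U D l V := by
  obtain ⟨a, ha, h⟩ := hV
  exact (sum (Finset.range k) fun j hj =>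
    smul (ha j) (of_lt ((Finset.mem_range.1 hj).trans_le hkl))).congr h

theorem contDiffOn (hD : ∀ j, ContDiffOn ℝ ∞ (D j) U) (hV : IsSmoothCombination U D k V) :
    ContDiffOn ℝ ∞ V U := by
  obtain ⟨a, ha, h⟩ := hV
  exact (ContDiffOn.sum fun j _ => (ha j).smul (hD j)).congr h

/-- Leibniz rule: `a j • D j` contributes to `D j` and `D (j + 1)`, so the length grows by one. -/
theorem wirtingerCurve (hU : IsOpen U) (hD : ∀ j, ContDiffOn ℝ ∞ (D j) U)
    (hD' : ∀ j, Set.EqOn (wirtingerCurve (D j)) (D (j + 1)) U)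
    (hV : IsSmoothCombination U D k V) :
    IsSmoothCombination U D (k + 1) (wirtingerCurve V) := by
  obtain ⟨a, ha, h⟩ := hV
  have hdiff : ∀ {E : Type} [NormedAddCommGroup E] [NormedSpace ℝ E] {g : ℂ → E},
      ContDiffOn ℝ ∞ g U → ∀ z ∈ U, DifferentiableAt ℝ g z := fun hg z hz =>
    (hg.contDiffAt (hU.mem_nhds hz)).differentiableAt (by simp)
  refine (sum (Finset.range k) fun j hj => (smul (contDiffOn_wirtingerScalar hU (ha j))
    (of_lt (D := D) (j := j) (k := k + 1) (by simp at hj; omega))).add (smul (ha j)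
    (of_lt (D := D) (j := j + 1) (k := k + 1) (by simp at hj; omega)))).congr fun z hz => ?_
  rw [wirtingerCurve_eq_of_eqOn hU h hz, wirtingerCurve_sum _ fun j _ =>
    (hdiff (ha j) z hz).fun_smul (hdiff (hD j) z hz)]
  refine Finset.sum_congr rfl fun j _ => ?_
  rw [wirtingerCurve_smul (hdiff (ha j) z hz) (hdiff (hD j) z hz), hD' j hz]

end IsSmoothCombination

/-! ### Covariant derivatives for a projectively flat connection. -/

theorem covariantDeriv_eq {n : ℕ} {Γ : (Fin n → ℂ) → Fin n → Fin n → Fin n → ℂ}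
    {f : ℂ → Fin n → ℂ} {z : ℂ} {p : Fin n → ℂ}
    (hΓ : ∀ i j k, Γ (f z) i j k = p i * (1 : Matrix (Fin n) (Fin n) ℂ) j k +
      p j * (1 : Matrix (Fin n) (Fin n) ℂ) i k) (V : ℂ → Fin n → ℂ) :
    covariantDeriv Γ f V z =
      wirtingerCurve V z + (∑ i, deriv f z i * p i) • V z + (∑ j, V z j * p j) • deriv f z := by
  ext k
  simp only [covariantDeriv, hΓ, Matrix.one_apply, mul_ite, mul_one, mul_zero, mul_add,
    Finset.sum_add_distrib, Finset.sum_ite_eq', Finset.mem_univ, if_true, Pi.add_apply,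
    Pi.smul_apply, smul_eq_mul, Finset.sum_mul]
  rw [add_assoc]
  congr 2
  · exact Finset.sum_congr rfl fun i _ => by ring
  · rw [Finset.sum_comm]
    simp only [Finset.sum_ite_eq', Finset.mem_univ, if_true]
    exact Finset.sum_congr rfl fun i _ => by ring

/-- Here `D k` is the ordinary derivative of order `k + 1`, the order of `jet Γ f k`; at `k = 0` the
combination is empty. In the inductive step the multiple of `V` has length `k + 1` and the multiple
of `f'` involves only `D 0`, so neither reaches `D (k + 1)`. -/
theorem jet_sub_isSmoothCombination {n : ℕ} {U : Set ℂ} (hU : IsOpen U)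
    {f : ℂ → Fin n → ℂ} (hf : DifferentiableOn ℂ f U)
    {Γ : (Fin n → ℂ) → Fin n → Fin n → Fin n → ℂ} {p : Fin n → ℂ → ℂ}
    (hp : ∀ i, ContDiffOn ℝ ∞ (p i) U)
    (hΓ : ∀ z ∈ U, ∀ i j k, Γ (f z) i j k = p i z * (1 : Matrix (Fin n) (Fin n) ℂ) j k +
      p j z * (1 : Matrix (Fin n) (Fin n) ℂ) i k) (k : ℕ) :
    IsSmoothCombination U (fun k => iteratedDeriv (k + 1) f) k
      (fun z => jet Γ f k z - iteratedDeriv (k + 1) f z) := by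
  have hDd : ∀ j, DifferentiableOn ℂ (iteratedDeriv j f) U := by
    intro j
    induction j with
    | zero => simpa using hf
    | succ j ih => rw [iteratedDeriv_succ]; exact ih.deriv hU
  have hD : ∀ j, ContDiffOn ℝ ∞ (iteratedDeriv (j + 1) f) U := fun j =>
    ((hDd (j + 1)).contDiffOn hU).restrict_scalars ℝ
  have hD' : ∀ j, Set.EqOn (wirtingerCurve (iteratedDeriv (j + 1) f))
      (iteratedDeriv (j + 1 + 1) f) U := fun j z hz => by
    rw [wirtingerCurve_of_differentiableAt ((hDd (j + 1)).differentiableAt (hU.mem_nhds hz)),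
      ← iteratedDeriv_succ]
  have hcoord : ∀ {V : ℂ → Fin n → ℂ}, ContDiffOn ℝ ∞ V U → ∀ i,
      ContDiffOn ℝ ∞ (fun z => V z i) U := fun hV i => contDiffOn_pi.1 hV i
  induction k with
  | zero => exact IsSmoothCombination.zero.congr fun z _ => by simp [jet, iteratedDeriv_one]
  | succ k ih =>
    have hdiff := ih.contDiffOn hD
    have hjet : ContDiffOn ℝ ∞ (jet Γ f k) U := (hdiff.add (hD k)).congr fun z _ => by simp
    have hα : ContDiffOn ℝ ∞ (fun z => ∑ i, iteratedDeriv (0 + 1) f z i * p i z) U :=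
      ContDiffOn.sum fun i _ => (hcoord (hD 0) i).mul (hp i)
    have hβ : ContDiffOn ℝ ∞ (fun z => ∑ i, jet Γ f k z i * p i z) U :=
      ContDiffOn.sum fun i _ => (hcoord hjet i).mul (hp i)
    have hlow := ih.mono (Nat.le_succ k)
    have htop := IsSmoothCombination.of_lt (U := U) (D := fun k => iteratedDeriv (k + 1) f)
      (Nat.lt_succ_self k)
    have hbot := IsSmoothCombination.of_lt (U := U) (D := fun k => iteratedDeriv (k + 1) f)
      (Nat.succ_pos k)
    refine (((ih.wirtingerCurve hU hD hD').add ((hlow.add htop).smul hα)).add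
      (hbot.smul hβ)).congr fun z hz => ?_
    have hat : ∀ {V : ℂ → Fin n → ℂ}, ContDiffOn ℝ ∞ V U → DifferentiableAt ℝ V z := fun hg =>
      (hg.contDiffAt (hU.mem_nhds hz)).differentiableAt (by simp)
    have hw : wirtingerCurve (jet Γ f k) z = wirtingerCurve
        (fun z => jet Γ f k z - iteratedDeriv (k + 1) f z) z + iteratedDeriv (k + 1 + 1) f z := by
      rw [← hD' k hz, ← wirtingerCurve_add (hat hdiff) (hat (hD k))]
      simp
    simp only [jet, covariantDeriv_eq (hΓ z hz), hw, zero_add, iteratedDeriv_one, sub_add_cancel]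
    module

/-! ### Top-degree forms, unitriangular changes of frame and the Wronskian. -/

theorem alternatingMap_apply_eq_mul_det {n : ℕ} (η : (Fin n → ℂ) [⋀^Fin n]→ₗ[ℂ] ℂ)
    (v : Fin n → Fin n → ℂ) : η v = η (Pi.basisFun ℂ (Fin n)) * (Matrix.of v).det := by
  conv_lhs => rw [η.eq_smul_basis_det (Pi.basisFun ℂ (Fin n)), Pi.basisFun_det]
  rfl

theorem alternatingMap_apply_eq_of_unitriangular {n : ℕ} (η : (Fin n → ℂ) [⋀^Fin n]→ₗ[ℂ] ℂ)
    {v w : ℕ → Fin n → ℂ} (a : ℕ → ℕ → ℂ)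
    (h : ∀ k, v k = w k + ∑ j ∈ Finset.range k, a k j • w j) :
    η (fun i => v i) = η (fun i => w i) := by
  set M : Matrix (Fin n) (Fin n) ℂ :=
    1 + Matrix.of fun k j : Fin n => if j < k then a k j else 0 with hM
  have hmul : Matrix.of (fun i : Fin n => v i) = M * Matrix.of (fun i : Fin n => w i) := by
    ext k l
    rw [hM, add_mul, one_mul, Matrix.add_apply, Matrix.of_apply, h, Matrix.mul_apply]
    simp only [Pi.add_apply, Finset.sum_apply, Pi.smul_apply, smul_eq_mul, Matrix.of_apply,
      ite_mul, zero_mul, Fin.lt_def]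
    congr 1
    -- As `k < n`, cutting the sum over `range n` down to `j < k` gives the sum over `range k`.
    rw [Fin.sum_univ_eq_sum_range (fun j => if j < (k : ℕ) then a k j * w j l else 0) n,
      ← Finset.sum_filter]
    refine Finset.sum_congr ?_ fun _ _ => rfl
    ext j
    simp
    omega
  have hdet : M.det = 1 := by
    rw [Matrix.det_of_isLowerTriangular]
    · simp [hM]
    · intro i j hij
      have hij' : i < j := hij
      simp [hM, Matrix.one_apply_ne hij'.ne, hij'.le]
  rw [alternatingMap_apply_eq_mul_det η fun i : Fin n => v i,
    alternatingMap_apply_eq_mul_det η fun i : Fin n => w i, hmul, Matrix.det_mul, hdet,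
    one_mul]

theorem DifferentiableOn.alternatingMap_apply {n : ℕ} (η : (Fin n → ℂ) [⋀^Fin n]→ₗ[ℂ] ℂ)
    {U : Set ℂ} {v : Fin n → ℂ → Fin n → ℂ} (hv : ∀ i, DifferentiableOn ℂ (v i) U) :
    DifferentiableOn ℂ (fun z => η (fun i => v i z)) U := by
  have hv' : ∀ i j, DifferentiableOn ℂ (fun z => v i z j) U := fun i j =>
    differentiableOn_pi.1 (hv i) j
  have he : (fun z => η (fun i => v i z)) = fun z =>
      η (Pi.basisFun ℂ (Fin n)) * (Matrix.of fun i => v i z).det :=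
    funext fun z => alternatingMap_apply_eq_mul_det η _
  simp only [he, Matrix.det_apply]
  refine DifferentiableOn.const_mul (DifferentiableOn.fun_sum fun σ _ => ?_) _
  exact DifferentiableOn.const_smul (DifferentiableOn.fun_finsetProd fun i _ => hv' _ _) _

/-- The non-holomorphic coefficients enter only below the diagonal, so they drop out of the
determinant; `p` may be merely smooth. -/
theorem isHolomorphicOn_wronskian {n : ℕ} {U : Set ℂ} (hU : IsOpen U)
    {f : ℂ → Fin n → ℂ} (hf : DifferentiableOn ℂ f U)
    {Γ : (Fin n → ℂ) → Fin n → Fin n → Fin n → ℂ} {p : Fin n → ℂ → ℂ}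
    (hp : ∀ i, ContDiffOn ℝ ∞ (p i) U)
    (hΓ : ∀ z ∈ U, ∀ i j k, Γ (f z) i j k = p i z * (1 : Matrix (Fin n) (Fin n) ℂ) j k +
      p j z * (1 : Matrix (Fin n) (Fin n) ℂ) i k) :
    IsHolomorphicOn (wronskian Γ f) U := by
  intro η
  have hDd : ∀ j, DifferentiableOn ℂ (iteratedDeriv j f) U := by
    intro j
    induction j with
    | zero => simpa using hf
    | succ j ih => rw [iteratedDeriv_succ]; exact ih.deriv hU
  choose a _ ha using jet_sub_isSmoothCombination hU hf hp hΓ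
  refine (DifferentiableOn.alternatingMap_apply η (v := fun i : Fin n =>
    iteratedDeriv (i + 1) f) fun i => hDd _).congr fun z hz => ?_
  exact alternatingMap_apply_eq_of_unitriangular η (v := fun k => jet Γ f k z)
    (w := fun k => iteratedDeriv (k + 1) f z) (fun k j => a k j z) fun k => by
      rw [← ha k z hz]; simp

theorem contDiffOn_inv_ballRho {n : ℕ} :
    ContDiffOn ℝ ∞ (fun x : Fin n → ℂ => (ballRho x)⁻¹) (unitBall n) := by
  have hc : ∀ i, ContDiff ℝ ∞ fun x : Fin n → ℂ => x i := fun i => contDiff_apply ℝ ℂ i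
  have h : ContDiff ℝ ∞ (ballRho : (Fin n → ℂ) → ℂ) :=
    contDiff_const.sub (ContDiff.sum fun i _ =>
      (hc i).mul (Complex.conjCLE.contDiff.comp (hc i)))
  exact h.contDiffOn.inv fun x hx => ballRho_ne_zero hx

end BergmanWronskian
end

open BergmanWronskian in
theorem mainTheorem4 (n : ℕ) (U : Set ℂ) (hU : IsOpen U) (f : ℂ → (Fin n → ℂ))
    (hf : DifferentiableOn ℂ f U)
    (hfB : Set.MapsTo f U (BergmanWronskian.unitBall n)) :
    BergmanWronskian.IsHolomorphicOn
      (BergmanWronskian.wronskian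
        (BergmanWronskian.christoffel
          (BergmanWronskian.bergmanMetric (BergmanWronskian.unitBall n))) f) U := by
  have hfs : ContDiffOn ℝ (⊤ : ℕ∞) f U := (hf.contDiffOn hU).restrict_scalars ℝ
  refine isHolomorphicOn_wronskian hU hf
    -- This is `∂_i (-log (1 - ‖x‖²))` evaluated along `f`.
    (p := fun i z => starRingEnd ℂ (f z i) * (ballRho (f z))⁻¹) (fun i => ?_)
    fun z hz i j k => christoffel_bergmanMetric_unitBall (hfB hz) i j k
  exact (Complex.conjCLE.contDiff.comp_contDiffOn (contDiffOn_pi.1 hfs i)).mul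
    (contDiffOn_inv_ballRho.comp hfs hfB)
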